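/- **Setting.** Let $\mathcal X,\mathcal A$ be countable and $H\ge 1$. A reward-free MDP $M$ consists of an initial distribution $P_0^M\in\Delta(\mathcal X)$ and transition distributions $P_h^M:\mathcal X\times\mathcal A\to\Delta(\mathcal X)$, $h=1,\dots,H$. A (randomized, non-stationary) policy is $\pi=(\pi_1,\dots,\pi_H)$ with $\pi_h:\mathcal X\to\Delta(\mathcal A)$. Executing $\pi$ in $M$ draws $x_1\sim P_0^M$, $a_h\sim\pi_h(x_h)$, $x_{h+1}\sim P_h^M(\cdot\mid x_h,a_h)$; $M(\pi)$ is the law of the trajectory $(x_1,a_1),\dots,(x_H,a_H)$, $\mathbb E^{M,\pi}$ the corresponding expectation, and $d_h^{M,\pi}(x,a)$ the probability that $(x_h,a_h)=(x,a)$. Fix a set $\Pi$ of policies; for $p\in\Delta(\Pi)$ put $d_h^{M,p}=\mathbb E_{\pi\sim p}[d_h^{M,\pi}]$ and, for $\varepsilon>0$, $$\Psi^M_{h,\varepsilon}(p)=\sup_{\pi\in\Pi}\mathbb E^{M,\pi}\left[\frac{d_h^{M,\pi}(x_h,a_h)}{d_h^{M,p}(x_h,a_h)+\varepsilon\, d_h^{M,\pi}(x_h,a_h)}\right].$$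 Write $D_{\mathsf H}^2(P,Q)=\sum_\tau(\sqrt{P(\tau)}-\sqrt{Q(\tau)})^2$ for distributions on trajectories. **Oracle.** Let $\mathcal M$ be a class of MDPs, $T\ge1$ and $\delta\in(0,1)$. An online estimation oracle for $\mathcal M$ with error bound $\mathrm{Est}=\mathrm{Est}^{\mathsf{on}}_{\mathsf H}(\mathcal M,T,\delta)\ge 0$ returns in each round $t\in\{1,\dots,T\}$, given the data $(\pi^1,o^1),\dots,(\pi^{t-1},o^{t-1})$ with $\pi^i\sim q^i$ and $o^i\sim M^\star(\pi^i)$, an estimate $\widehat M^t\in\mathcal M$, such that whenever $M^\star\in\mathcal M$, and for any adaptive choice of the distributions $q^t\in\Delta(\Pi)$ (where $q^t$ may depend on everything up to and including $\widehat M^t$), with probability at least $1-\delta$, $$\sum_{t=1}^T\mathbb E_{\pi\sim q^t}\left[D_{\mathsf H}^2\big(\widehat M^t(\pi),M^\star(\pi)\big)\right]\le \mathrm{Est}.$$ **Algorithm** (parameters $T\ge 1$, $C\ge1$, $\varepsilon>0$). For $t=1,\dots,T$: obtain $\widehat M^t$ from the oracle; for each $h\in\{1,\dots,H\}$ compute some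 $p_h^t\in\Delta(\Pi)$ with $\Psi^{\widehat M^t}_{h,\varepsilon}(p_h^t)\le C$ (the plug-in cover problem); sample $\pi^t\sim q^t=\mathrm{Unif}(p_1^t,\dots,p_H^t)$ and observe $o^t\sim M^\star(\pi^t)$. Return $p_h=\mathrm{Unif}(p_h^1,\dots,p_h^T)$ for $h=1,\dots,H$, where $\mathrm{Unif}$ denotes the uniform mixture. **Theorem.** Suppose that $M^\star\in\mathcal M$, that the algorithm is run with an online estimation oracle for $\mathcal M$ with error bound $\mathrm{Est}$ at confidence $\delta$, and that (almost surely) the plug-in cover problem is feasible in every round $t$ and for every $h$. Then with probability at least $1-\delta$, simultaneously for all $h\in\{1,\dots,H\}$, $$\Psi^{M^\star}_{h,\varepsilon}(p_h)\le 11HC+\frac{12}{\varepsilon}\sqrt{\frac{H^3C\,\mathrm{Est}}{T}}+\frac{8H}{\varepsilon^2}\cdot\frac{\mathrm{Est}}{T}.$$ -/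

import Mathlib

open MeasureTheory ProbabilityTheory
open scoped ENNReal

namespace RewardFree

noncomputable section

/-- The σ-algebra on the set of distributions over `α` generated by the evaluations
`p ↦ p a`. -/
instance instMeasurableSpacePMF {α : Type*} : MeasurableSpace (PMF α) :=
  MeasurableSpace.comap (fun p : PMF α => (fun a : α => p a)) inferInstance

/-- A reward-free Markov decision process with horizon `H`: the distribution of the first state,
and for each layer a transition kernel. Layers `1, …, H` are indexed by `Fin H`
(so layer `h` is the index `h - 1`). -/
structure MDP (X A : Type*) (H : ℕ) where
  init : PMF X
  trans : Fin H → X → A → PMF X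

instance instMeasurableSpaceMDP {X A : Type*} {H : ℕ} : MeasurableSpace (MDP X A H) :=
  MeasurableSpace.comap (fun M : MDP X A H => (M.init, M.trans)) inferInstance

/-- Randomized non-stationary policies. -/
abbrev Policy (X A : Type*) (H : ℕ) := Fin H → X → PMF A

/-- Trajectories `(x₁, a₁), …, (x_H, a_H)`. -/
abbrev Traj (X A : Type*) (H : ℕ) := Fin H → X × A

section Dynamics

variable {X A : Type*} {H : ℕ}

/-- The law of the next state after the first `n` state-action pairs. -/
def MDP.next (M : MDP X A H) : (n : ℕ) → n < H → (Fin n → X × A) → PMF X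
  | 0, _, _ => M.init
  | n + 1, hn, τ =>
      M.trans ⟨n, Nat.lt_of_succ_lt hn⟩ (τ (Fin.last n)).1 (τ (Fin.last n)).2

/-- The law of the first `n` state-action pairs when policy `π` is executed in `M`:
each round draws the state `x` from the dynamics, then the action `a` from the policy at `x`. -/
def MDP.prefixLaw (M : MDP X A H) (π : Policy X A H) :
    (n : ℕ) → n ≤ H → PMF (Fin n → X × A)
  | 0, _ => PMF.pure (fun i => i.elim0)
  | n + 1, hn =>
      (M.prefixLaw π n (Nat.le_of_succ_le hn)).bind fun τ =>
        (M.next n hn τ).bind fun x =>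
          (π ⟨n, hn⟩ x).bind fun a =>
            PMF.pure (Fin.snoc (α := fun _ => X × A) τ (x, a))

/-- `M(π)`: the law of the trajectory when policy `π` is executed in `M`. -/
def MDP.law (M : MDP X A H) (π : Policy X A H) : PMF (Traj X A H) :=
  M.prefixLaw π H le_rfl

/-- The expectation of a nonnegative function of the trajectory under `M(π)`. -/
def MDP.expect (M : MDP X A H) (π : Policy X A H) (g : Traj X A H → ℝ≥0∞) : ℝ≥0∞ :=
  ∑' τ, M.law π τ * g τ

/-- The occupancy measure `d_h^{M,π}(x,a)`, as a function of `z = (x,a)`. -/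
def MDP.occ (M : MDP X A H) (π : Policy X A H) (h : Fin H) (z : X × A) : ℝ≥0∞ :=
  ((M.law π).map fun τ => τ h) z

/-- The occupancy `d_h^{M,p}(x,a)` of a policy ensemble `p`, averaged over `π ∼ p`. -/
def MDP.occMix (M : MDP X A H) {Pol : Set (Policy X A H)} (p : ProbabilityMeasure Pol)
    (h : Fin H) (z : X × A) : ℝ≥0∞ :=
  ∫⁻ π : Pol, M.occ π h z ∂(p : Measure Pol)

/-- The `L₁`-coverage objective `Ψ^M_{h,ε}(p)`. -/
def MDP.coverage (M : MDP X A H) {Pol : Set (Policy X A H)} (h : Fin H) (ε : ℝ)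
    (p : ProbabilityMeasure Pol) : ℝ≥0∞ :=
  ⨆ π : Pol, M.expect π fun τ =>
    M.occ π h (τ h) / (M.occMix p h (τ h) + ENNReal.ofReal ε * M.occ π h (τ h))

end Dynamics

/-- The squared Hellinger distance of two distributions on a discrete space (the dominating
measure is the counting measure; no factor `1/2`). -/
def hellingerSq {α : Type*} (P Q : PMF α) : ℝ≥0∞ :=
  ∑' a, ENNReal.ofReal ((√(P a).toReal - √(Q a).toReal) ^ 2)

/-- The uniform mixture `Unif(p₁, …, pₙ)` of `n ≥ 1` probability measures. -/
def unifMix {α : Type*} [MeasurableSpace α] {n : ℕ} [NeZero n]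
    (p : Fin n → ProbabilityMeasure α) : ProbabilityMeasure α :=
  ⟨(n : ℝ≥0∞)⁻¹ • ∑ i, (p i : Measure α), ⟨by
    simp [ENNReal.inv_mul_cancel (NeZero.ne (n : ℝ≥0∞)) (ENNReal.natCast_ne_top n)]⟩⟩

/-- `κ` is the conditional law of the random variable `Y` given the σ-algebra `𝓖`. -/
structure HasCondLaw {Ω α : Type*} [MeasurableSpace Ω] [MeasurableSpace α] (P : Measure Ω)
    (𝓖 : MeasurableSpace Ω) (Y : Ω → α) (κ : Ω → Measure α) : Prop where
  measurable_kernel : Measurable[𝓖] κ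
  measure_inter : ∀ S : Set Ω, MeasurableSet[𝓖] S → ∀ B : Set α, MeasurableSet B →
    P (S ∩ Y ⁻¹' B) = ∫⁻ ω in S, κ ω B ∂P

section Learning

variable {X A : Type*} [MeasurableSpace X] [MeasurableSpace A] {H T : ℕ}
  {Pol : Set (Policy X A H)} {Mcl : Set (MDP X A H)}

/-- A (possibly randomized) proper estimation algorithm for the model class `Mcl`: after `t`
episodes it maps the data `(π¹,o¹), …, (πᵗ,oᵗ)` to (the law of) an estimate in `Mcl`. -/
structure EstimationAlg (Pol : Set (Policy X A H)) (Mcl : Set (MDP X A H)) where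
  est : (t : ℕ) → Kernel (Fin t → Pol × Traj X A H) Mcl
  markov : ∀ t, IsMarkovKernel (est t)

/-- The data `(πⁱ,oⁱ)`, `i < t`, collected before round `t`. -/
def history {Ω : Type*} (pol : Fin T → Ω → Pol) (obs : Fin T → Ω → Traj X A H) (t : Fin T)
    (ω : Ω) : Fin t → Pol × Traj X A H :=
  fun i => (pol ⟨i, i.2.trans t.2⟩ ω, obs ⟨i, i.2.trans t.2⟩ ω)

/-- `T` rounds of interaction with the MDP `Mstar`. In round `t`, the estimate `Mhat t` is drawn
by the estimation algorithm from the data collected so far, a distribution `q t` over policies is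
chosen (arbitrarily, possibly depending on all that happened so far, including `Mhat t`), the
policy `pol t` is drawn from `q t`, and the trajectory `obs t` is drawn from `Mstar (pol t)`.
`𝓕 t` is the information available before round `t`, and `𝓖 t` the information available in
round `t` just before the policy is drawn. -/
structure IsInteraction {Ω : Type*} [mΩ : MeasurableSpace Ω] (P : Measure Ω)
    (alg : EstimationAlg Pol Mcl) (Mstar : MDP X A H) (𝓕 𝓖 : Fin T → MeasurableSpace Ω)
    (Mhat : Fin T → Ω → Mcl) (q : Fin T → Ω → ProbabilityMeasure Pol)
    (pol : Fin T → Ω → Pol) (obs : Fin T → Ω → Traj X A H) : Prop where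
  before_le : ∀ t, 𝓕 t ≤ 𝓖 t
  round_le : ∀ s t, s < t → 𝓖 s ≤ 𝓕 t
  le_ambient : ∀ t, 𝓖 t ≤ mΩ
  measurable_pol : ∀ t, Measurable (pol t)
  measurable_obs : ∀ t, Measurable (obs t)
  pol_known : ∀ s t, s < t → Measurable[𝓕 t] (pol s)
  obs_known : ∀ s t, s < t → Measurable[𝓕 t] (obs s)
  Mhat_known : ∀ t, Measurable[𝓖 t] (Mhat t)
  q_known : ∀ t, Measurable[𝓖 t] fun ω => (q t ω : Measure Pol)
  Mhat_law : ∀ t, HasCondLaw P (𝓕 t) (Mhat t) fun ω => alg.est t (history pol obs t ω)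
  pol_law : ∀ t, HasCondLaw P (𝓖 t) (pol t) fun ω => (q t ω : Measure Pol)
  obs_law : ∀ t, HasCondLaw P (𝓖 t ⊔ MeasurableSpace.comap (pol t) inferInstance) (obs t)
    fun ω => (Mstar.law (pol t ω)).toMeasure

/-- The cumulative Hellinger error `∑ₜ E_{π ∼ qᵗ} [D²_H(M̂ᵗ(π), M⋆(π))]`. -/
def estError (Mstar : MDP X A H) (Mhat : Fin T → Mcl) (q : Fin T → ProbabilityMeasure Pol) :
    ℝ≥0∞ :=
  ∑ t, ∫⁻ π : Pol, hellingerSq ((Mhat t : MDP X A H).law π) (Mstar.law π) ∂(q t : Measure Pol)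

/-- `alg` is an online estimation oracle for `Mcl` with error bound `Est` over `T` rounds at
confidence `δ`: whenever the true MDP is in `Mcl`, and however the distributions `q t` are
chosen in the course of the interaction, the cumulative Hellinger error is at most `Est`, except
on an event of probability at most `δ`. -/
def IsOnlineOracle.{w} (alg : EstimationAlg Pol Mcl) (T : ℕ) (δ Est : ℝ) : Prop :=
  ∀ Mstar ∈ Mcl, ∀ (Ω : Type w) [MeasurableSpace Ω] (P : Measure Ω) [IsProbabilityMeasure P]
    (𝓕 𝓖 : Fin T → MeasurableSpace Ω) (Mhat : Fin T → Ω → Mcl)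
    (q : Fin T → Ω → ProbabilityMeasure Pol) (pol : Fin T → Ω → Pol)
    (obs : Fin T → Ω → Traj X A H),
    IsInteraction P alg Mstar 𝓕 𝓖 Mhat q pol obs →
      P {ω | ¬ estError Mstar (fun t => Mhat t ω) (fun t => q t ω) ≤ ENNReal.ofReal Est}
        ≤ ENNReal.ofReal δ

/-- The plug-in problem for the model `M` at layer `h`: some `p ∈ Δ(Pol)` has coverage at most
`C` in `M`. -/
def PlugInFeasible (Pol : Set (Policy X A H)) (M : MDP X A H) (h : Fin H) (ε C : ℝ) : Prop :=
  ∃ p : ProbabilityMeasure Pol, M.coverage h ε p ≤ ENNReal.ofReal C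

/-- A run of the model-based exploration algorithm in `Mstar`: in round `t` it estimates
`Mhat t`, computes for each layer `h` a plug-in cover `p t h` (a solution of the plug-in problem
for `Mhat t`, if there is one), draws `pol t` from `Unif(p t 1, …, p t H)` and observes the
trajectory `obs t`. -/
structure IsRun [NeZero H] {Ω : Type*} [MeasurableSpace Ω] (P : Measure Ω)
    (alg : EstimationAlg Pol Mcl) (C ε : ℝ) (Mstar : MDP X A H)
    (𝓕 𝓖 : Fin T → MeasurableSpace Ω) (Mhat : Fin T → Ω → Mcl)
    (p : Fin T → Fin H → Ω → ProbabilityMeasure Pol)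
    (pol : Fin T → Ω → Pol) (obs : Fin T → Ω → Traj X A H) : Prop where
  interaction : IsInteraction P alg Mstar 𝓕 𝓖 Mhat (fun t ω => unifMix fun h => p t h ω) pol obs
  cover_known : ∀ t h, Measurable[𝓖 t] fun ω => (p t h ω : Measure Pol)
  cover_solves : ∀ᵐ ω ∂P, ∀ t h, PlugInFeasible Pol (Mhat t ω) h ε C →
    (Mhat t ω : MDP X A H).coverage h ε (p t h ω) ≤ ENNReal.ofReal C

end Learning

end

end RewardFree

open RewardFree

universe u v w

namespace RewardFree

/-! ### Sums of extended nonnegative reals -/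

/-! The argument is deterministic once the oracle's error bound holds. Fix a round with estimate `M`
and true model `N`, and let `p h` cover layer `h` of `M` with value at most `C`. The sampling
distribution is the uniform mixture of the `p h`, so the Hellinger error `e` under each `p h` is at
most `H` times the round's error.

The crux is to control the one-step model errors under an arbitrary policy `π`, although the error
is known to be small only under `p h`. The errors are one-sided total variations `δ z ≤ 1`, and
their squares, averaged over the occupancy of `p h` in `M`, are at most `10 * e`
(`mul_sq_tsum_tsub_le`). Cauchy-Schwarz with the coverage weights changes the measure from `p h` to
`π`: for `y = ∑ z, d^π z * δ z` it gives `y ^ 2 ≤ C * (10 * e + ε * y)`, hence `y ≤ C * ε + √(10 * C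
* e)` (`MDP.tsum_occ_mul_transErr_le`). Only coverage in `M` enters, and that is what the plug-in
problem provides.

Adding these errors over the layers shows that occupancies of `π` in `N` exceed those in `M` by a
function of total mass at most `H * y` (`MDP.exists_occ_le_add`, with `y` replaced by its bound).
The ensemble occupancy in `M` is at most twice that in `N` plus a Hellinger term
(`MDP.exists_occMix_le`). Substituting both in the coverage ratio (`mul_div_le_of_le_add`) gives
coverage in `N`. Convexity of the ratio in the denominator (`div_avg_le`) and concavity of the
square root then average the bound over rounds. -/

/-- The Cauchy-Schwarz inequality for sums. -/
theorem sq_tsum_le_of_sq_le_mul {ι : Type*} {k f g : ι → ℝ≥0∞} (hf : ∑' i, f i ≠ ∞)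
    (hg : ∑' i, g i ≠ ∞) (hk : ∀ i, k i ^ 2 ≤ f i * g i) :
    (∑' i, k i) ^ 2 ≤ (∑' i, f i) * ∑' i, g i := by
  have hf' := fun i => ENNReal.ne_top_of_tsum_ne_top hf i
  have hg' := fun i => ENNReal.ne_top_of_tsum_ne_top hg i
  have hk' : ∀ i, k i ≠ ∞ := fun i hi => by
    have := hk i
    rw [hi, ENNReal.top_pow two_ne_zero, top_le_iff] at this
    exact ENNReal.mul_ne_top (hf' i) (hg' i) this
  have key : ∀ s : Finset ι, (∑ i ∈ s, k i) ^ 2 ≤ (∑' i, f i) * ∑' i, g i := fun s => by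
    refine le_trans ?_ (mul_le_mul' (ENNReal.sum_le_tsum s) (ENNReal.sum_le_tsum s))
    clear hf hg
    lift k to ι → NNReal using hk'
    lift f to ι → NNReal using hf'
    lift g to ι → NNReal using hg'
    have := Finset.sum_sq_le_sum_mul_sum_of_sq_le_mul s (r := k) (f := f) (g := g)
      (fun _ _ => zero_le) (fun _ _ => zero_le) (fun i _ => by have := hk i; dsimp only at this; exact_mod_cast this)
    dsimp only
    exact_mod_cast this
  -- With the square root on the right, the bound passes to the supremum of the finite partial sums.
  have h2 : (∑' i, k i) ≤ ((∑' i, f i) * ∑' i, g i) ^ (1 / 2 : ℝ) := by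
    rw [ENNReal.tsum_eq_iSup_sum]
    refine iSup_le fun s => ?_
    rw [one_div, ENNReal.le_rpow_inv_iff two_pos, ENNReal.rpow_two]
    exact key s
  rwa [one_div, ENNReal.le_rpow_inv_iff two_pos, ENNReal.rpow_two] at h2

/-- The lower integral is superadditive, so this direction needs no measurability of `f`. -/
theorem tsum_lintegral_le_lintegral_tsum {ι α : Type*} [MeasurableSpace α] (μ : Measure α)
    (f : ι → α → ℝ≥0∞) : ∑' i, ∫⁻ a, f i a ∂μ ≤ ∫⁻ a, ∑' i, f i a ∂μ := by
  classical
  rw [ENNReal.tsum_eq_iSup_sum]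
  refine iSup_le fun s => le_trans ?_ (lintegral_mono fun a => ENNReal.sum_le_tsum s)
  induction s using Finset.induction_on with
  | empty => simp
  | insert i s hi ih =>
    simp only [Finset.sum_insert hi]
    exact (add_le_add_right ih _).trans (le_lintegral_add _ _)

/-! ### Pushing weights forward along a map. -/

/-- The sum of `F` over the fibre of `f` at `b`. -/
noncomputable def fiberSum {α β : Type*} (f : α → β) (F : α → ℝ≥0∞) (b : β) : ℝ≥0∞ :=
  open Classical in ∑' a, if b = f a then F a else 0

section FiberSum

variable {α β : Type*} (f : α → β) (F G : α → ℝ≥0∞)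

theorem fiberSum_le {F G : α → ℝ≥0∞} (h : ∀ a, F a ≤ G a) (b : β) :
    fiberSum f F b ≤ fiberSum f G b :=
  ENNReal.tsum_le_tsum fun a => by split_ifs <;> simp [h]

theorem fiberSum_add (b : β) :
    fiberSum f (fun a => F a + G a) b = fiberSum f F b + fiberSum f G b := by
  rw [fiberSum, fiberSum, fiberSum, ← ENNReal.tsum_add]
  exact tsum_congr fun a => by split_ifs <;> simp

theorem fiberSum_const_mul (c : ℝ≥0∞) (b : β) :
    fiberSum f (fun a => c * F a) b = c * fiberSum f F b := by
  rw [fiberSum, fiberSum, ← ENNReal.tsum_mul_left]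
  exact tsum_congr fun a => by split_ifs <;> simp

theorem tsum_mul_fiberSum (g : β → ℝ≥0∞) :
    ∑' b, fiberSum f F b * g b = ∑' a, F a * g (f a) := by
  classical
  simp only [fiberSum, ← ENNReal.tsum_mul_right]
  rw [ENNReal.tsum_comm]
  refine tsum_congr fun a => ?_
  rw [tsum_eq_single (f a)]
  · simp
  · intro b hb
    simp [hb]

theorem tsum_fiberSum : ∑' b, fiberSum f F b = ∑' a, F a := by
  simpa using tsum_mul_fiberSum f F (fun _ => 1)

theorem PMF.map_eq_fiberSum (p : PMF α) (b : β) : (p.map f) b = fiberSum f p b := by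
  rw [PMF.map_apply]; rfl

end FiberSum

/-! ### Comparing a distribution with a Hellinger perturbation -/

/-- The squared difference of the square roots, a term of the squared Hellinger distance. -/
noncomputable def sqrtDist (x y : ℝ≥0∞) : ℝ≥0∞ := ENNReal.ofReal ((√x.toReal - √y.toReal) ^ 2)

theorem hellingerSq_eq {α : Type*} (P Q : PMF α) : hellingerSq P Q = ∑' a, sqrtDist (P a) (Q a) :=
  rfl

/-- The slack is the square `(√x - 2√y)²`. This compares masses in the two models without any lower
bound on them. -/
theorem le_two_mul_add_sqrtDist {x y : ℝ≥0∞} (hx : x ≠ ∞) (hy : y ≠ ∞) :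
    x ≤ 2 * y + 2 * sqrtDist x y := by
  lift x to NNReal using hx
  lift y to NNReal using hy
  rw [← ENNReal.toReal_le_toReal (by simp) (by simp [sqrtDist, ENNReal.mul_eq_top]),
    ENNReal.toReal_add (by simp [ENNReal.mul_eq_top]) (by simp [sqrtDist, ENNReal.mul_eq_top])]
  simp only [sqrtDist, ENNReal.toReal_mul, ENNReal.toReal_ofReal (sq_nonneg _),
    ENNReal.coe_toReal, ENNReal.toReal_ofNat]
  nlinarith [Real.sq_sqrt x.coe_nonneg, Real.sq_sqrt y.coe_nonneg, sq_nonneg (√(x : ℝ) - 2 * √(y : ℝ))]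

theorem sqrtDist_comm (x y : ℝ≥0∞) : sqrtDist x y = sqrtDist y x := by
  rw [sqrtDist, sqrtDist, ← neg_sub, neg_sq]

/-- The truncated differences add up to `|x - y| = |√x - √y| (√x + √y)`, and `(√x + √y)² ≤ 2 (x +
y)`. -/
theorem tsub_add_tsub_sq_le {x y : ℝ≥0∞} (hx : x ≠ ∞) (hy : y ≠ ∞) :
    ((x - y) + (y - x)) ^ 2 ≤ sqrtDist x y * (2 * (x + y)) := by
  wlog h : y ≤ x generalizing x y
  · rw [add_comm (x - y), add_comm x, sqrtDist_comm]
    exact this hy hx (le_of_not_ge h)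
  lift x to NNReal using hx
  lift y to NNReal using hy
  rw [tsub_eq_zero_of_le h, add_zero,
    ← ENNReal.toReal_le_toReal (by simp)
      (by simp [sqrtDist, ENNReal.mul_eq_top])]
  simp only [sqrtDist, ENNReal.toReal_mul, ENNReal.toReal_ofReal (sq_nonneg _),
    ENNReal.toReal_pow, ENNReal.toReal_sub_of_le h ENNReal.coe_ne_top,
    ENNReal.toReal_add ENNReal.coe_ne_top ENNReal.coe_ne_top,
    ENNReal.coe_toReal, ENNReal.toReal_ofNat]
  have h1 := Real.sq_sqrt x.2
  have h2 := Real.sq_sqrt y.2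
  set s := √(x : ℝ)
  set t := √(y : ℝ)
  change s ^ 2 = (x : ℝ) at h1
  change t ^ 2 = (y : ℝ) at h2
  rw [← h1, ← h2]
  nlinarith [mul_nonneg (sq_nonneg (s - t)) (sq_nonneg (s - t))]

theorem tsum_sqrtDist_ne_top {α : Type*} {P Q : α → ℝ≥0∞} (hP : ∑' a, P a ≠ ∞)
    (hQ : ∑' a, Q a ≠ ∞) : ∑' a, sqrtDist (P a) (Q a) ≠ ∞ := by
  refine ne_top_of_le_ne_top (ENNReal.add_ne_top.2 ⟨hP, hQ⟩) ?_
  rw [← ENNReal.tsum_add]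
  refine ENNReal.tsum_le_tsum fun a => ?_
  have hx := ENNReal.ne_top_of_tsum_ne_top hP a
  have hy := ENNReal.ne_top_of_tsum_ne_top hQ a
  rw [← ENNReal.ofReal_toReal hx, ← ENNReal.ofReal_toReal hy, sqrtDist,
    ← ENNReal.ofReal_add ENNReal.toReal_nonneg ENNReal.toReal_nonneg]
  refine ENNReal.ofReal_le_ofReal ?_
  simp only [ENNReal.toReal_ofReal ENNReal.toReal_nonneg]
  nlinarith [Real.sq_sqrt (ENNReal.toReal_nonneg (a := P a)),
    Real.sq_sqrt (ENNReal.toReal_nonneg (a := Q a)),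
    mul_nonneg (Real.sqrt_nonneg (P a).toReal) (Real.sqrt_nonneg (Q a).toReal)]

/-- If two measures `P`, `Q` on `α` disintegrate over `f : α → β` with conditional laws `p`, `q`,
the one-sided total variation distance of `p` and `q` is controlled by the Hellinger distance of
`P` and `Q`. -/
theorem mul_sq_tsum_tsub_le {α β : Type*} {P Q : α → ℝ≥0∞} (f : α → β) {p q : β → ℝ≥0∞}
    {l m : ℝ≥0∞} (hq : ∑' b, q b = 1) (hP : ∑' a, P a = l)
    (hQ : ∑' a, Q a = m) (hl : l ≠ ∞) (hm : m ≠ ∞)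
    (hPf : ∀ b, fiberSum f P b = l * p b) (hQf : ∀ b, fiberSum f Q b = m * q b) :
    l * (∑' b, (q b - p b)) ^ 2 ≤ 10 * ∑' a, sqrtDist (P a) (Q a) := by
  subst hP hQ
  have hPa := fun a => ENNReal.ne_top_of_tsum_ne_top hl a
  have hQa := fun a => ENNReal.ne_top_of_tsum_ne_top hm a
  set l := ∑' a, P a
  set m := ∑' a, Q a
  set η := ∑' a, sqrtDist (P a) (Q a) with hη
  set D := ∑' b, (q b - p b) with hD
  have hη_top : η ≠ ∞ := tsum_sqrtDist_ne_top hl hm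
  have hD1 : D ≤ 1 := by
    rw [← hq]; exact ENNReal.tsum_le_tsum fun b => tsub_le_self
  -- On each fibre, replacing `l` by `m` costs the mass of `(P - Q)⁺` times `q b`, and replacing `Q`
  -- by `P` costs the fibre's share of `(Q - P)⁺`. Since `q` sums to one, the total is the `L₁`
  -- distance.
  have h1 : l * D ≤ ∑' a, ((P a - Q a) + (Q a - P a)) := by
    have hlm : l ≤ m + ∑' a, (P a - Q a) := by
      rw [← ENNReal.tsum_add]
      exact ENNReal.tsum_le_tsum fun a => le_add_tsub
    have hb : ∀ b, l * (q b - p b) ≤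
        fiberSum f (fun a => Q a - P a) b + (∑' a, (P a - Q a)) * q b := fun b => by
      rw [ENNReal.mul_sub (fun _ _ => hl), tsub_le_iff_left, ← hPf]
      calc l * q b ≤ (m + ∑' a, (P a - Q a)) * q b := by gcongr
        _ = fiberSum f Q b + (∑' a, (P a - Q a)) * q b := by rw [add_mul, hQf]
        _ ≤ fiberSum f (fun a => P a + (Q a - P a)) b + (∑' a, (P a - Q a)) * q b := by
          gcongr
          exact fiberSum_le f (fun a => le_add_tsub) b
        _ = _ := by rw [fiberSum_add, add_assoc]
    calc l * D = ∑' b, l * (q b - p b) := by rw [ENNReal.tsum_mul_left]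
      _ ≤ ∑' b, (fiberSum f (fun a => Q a - P a) b + (∑' a, (P a - Q a)) * q b) :=
        ENNReal.tsum_le_tsum hb
      _ = _ := by
        rw [ENNReal.tsum_add, tsum_fiberSum, ENNReal.tsum_mul_left, hq, mul_one, add_comm,
          ENNReal.tsum_add]
  have h2 : (l * D) ^ 2 ≤ η * (2 * (l + m)) := by
    have h22 : ∑' a, 2 * (P a + Q a) = 2 * (l + m) := by
      rw [ENNReal.tsum_mul_left, ENNReal.tsum_add]
    rw [← h22]
    refine (pow_le_pow_left' h1 2).trans (sq_tsum_le_of_sq_le_mul hη_top ?_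
      fun a => tsub_add_tsub_sq_le (hPa a) (hQa a))
    rw [h22]
    exact ENNReal.mul_ne_top (by simp) (ENNReal.add_ne_top.2 ⟨hl, hm⟩)
  have h3 : m ≤ 2 * l + 2 * η := by
    rw [← ENNReal.tsum_mul_left, ← ENNReal.tsum_mul_left, ← ENNReal.tsum_add]
    refine ENNReal.tsum_le_tsum fun a => ?_
    rw [sqrtDist_comm]
    exact le_two_mul_add_sqrtDist (hQa a) (hPa a)
  -- If `η ≤ l`, then `m ≤ 4 * l` and `2 * (l + m) ≤ 10 * l`, the source of the constant 10.
  -- Otherwise `D ≤ 1` suffices.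
  rcases le_total η l with h | h
  · rcases eq_or_ne l 0 with h0 | h0
    · simp [h0]
    have : l * (l * D ^ 2) ≤ l * (10 * η) := by
      calc l * (l * D ^ 2) = (l * D) ^ 2 := by ring
        _ ≤ η * (2 * (l + m)) := h2
        _ ≤ η * (2 * (l + (2 * l + 2 * l))) := by
          gcongr
          exact h3.trans (by gcongr)
        _ = l * (10 * η) := by ring
    exact (ENNReal.mul_le_mul_iff_right h0 hl).1 this
  · calc l * D ^ 2 ≤ η * 1 := by
          gcongr
          exact pow_le_one₀ zero_le hD1
      _ ≤ 10 * η := by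
        rw [mul_comm]
        gcongr
        norm_num

/-! ### Elementary inequalities -/

/-- If `y > c + √z`, then `y² > c y + √z y ≥ c y + z`. This resolves the self-bounding inequality
produced by the change of measure. -/
theorem le_add_sqrt_of_sq_le {y c z : ℝ} (hc : 0 ≤ c) (hz : 0 ≤ z) (h : y ^ 2 ≤ c * y + z) :
    y ≤ c + √z := by
  by_contra! hlt
  nlinarith [Real.sq_sqrt hz, Real.sqrt_nonneg z]

/-! ### Marginals of the trajectory law -/

section Marginals

variable {X A : Type*} {H : ℕ} (M : MDP X A H) (π : Policy X A H)

/-- Later rounds integrate out, so marginals at given times can be computed in the shortest prefix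
containing them. -/
theorem MDP.prefixLaw_map_castLE {n m : ℕ} (hnm : n ≤ m) (hm : m ≤ H) :
    (M.prefixLaw π m hm).map (fun τ i => τ (Fin.castLE hnm i)) =
      M.prefixLaw π n (hnm.trans hm) := by
  induction m, hnm using Nat.le_induction with
  | base => exact PMF.map_id _
  | succ m hnm ih =>
    rw [← ih (Nat.le_of_succ_le hm), MDP.prefixLaw, PMF.map_bind]
    simp only [PMF.map_bind, PMF.pure_map]
    have : ∀ (τ : Fin m → X × A) (z : X × A), (fun i : Fin n =>
        (Fin.snoc (α := fun _ => X × A) τ z : Fin (m + 1) → X × A)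
          (Fin.castLE (Nat.le_succ_of_le hnm) i)) = fun i => τ (Fin.castLE hnm i) := by
      intro τ z
      funext i
      exact Fin.snoc_castSucc (α := fun _ => X × A) z τ (Fin.castLE hnm i)
    simp only [this, PMF.bind_const]
    rfl

theorem MDP.law_map_castLE {n : ℕ} (hn : n ≤ H) :
    (M.law π).map (fun τ i => τ (Fin.castLE hn i)) = M.prefixLaw π n hn :=
  M.prefixLaw_map_castLE π hn le_rfl

/-- The law of the `h`-th state-action pair. -/
noncomputable def MDP.occLaw (h : Fin H) : PMF (X × A) := (M.law π).map fun τ => τ h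

theorem MDP.occLaw_apply (h : Fin H) (z : X × A) : M.occLaw π h z = M.occ π h z := rfl

theorem MDP.map_last_prefixLaw {n : ℕ} (hn : n < H) :
    (M.prefixLaw π (n + 1) hn).map (fun τ => τ (Fin.last n)) = M.occLaw π ⟨n, hn⟩ := by
  rw [← M.law_map_castLE π hn, PMF.map_comp]
  rfl

theorem MDP.law_map_zero (h0 : 0 < H) :
    M.occLaw π ⟨0, h0⟩ =
      M.init.bind fun x => (π ⟨0, h0⟩ x).bind fun a => PMF.pure (x, a) := by
  rw [← M.map_last_prefixLaw π h0, MDP.prefixLaw, MDP.prefixLaw, PMF.pure_bind, PMF.map_bind]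
  simp only [PMF.map_bind, PMF.pure_map, Fin.snoc_last]
  rfl

theorem MDP.law_map_pair {n : ℕ} (hn : n + 1 < H) :
    (M.law π).map (fun τ => (τ ⟨n, Nat.lt_of_succ_lt hn⟩, τ ⟨n + 1, hn⟩)) =
      (M.occLaw π ⟨n, Nat.lt_of_succ_lt hn⟩).bind fun z =>
        (M.trans ⟨n, Nat.lt_of_succ_lt hn⟩ z.1 z.2).bind fun x =>
          (π ⟨n + 1, hn⟩ x).bind fun a => PMF.pure (z, (x, a)) := by
  have h1 : (M.law π).map (fun τ => (τ ⟨n, Nat.lt_of_succ_lt hn⟩, τ ⟨n + 1, hn⟩)) =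
      (M.prefixLaw π (n + 2) hn).map fun τ => (τ (Fin.last n).castSucc, τ (Fin.last (n + 1))) := by
    rw [← M.law_map_castLE π (n := n + 2) hn, PMF.map_comp]
    rfl
  rw [h1, MDP.prefixLaw, PMF.map_bind, ← M.map_last_prefixLaw π (Nat.lt_of_succ_lt hn),
    PMF.bind_map]
  simp only [PMF.map_bind, PMF.pure_map, Fin.snoc_last, Fin.snoc_castSucc]
  rfl

theorem PMF.bind_map_prodMk_apply {α β : Type*} (p : PMF α) (k : α → PMF β) (a : α) (b : β) :
    (p.bind fun a => (k a).bind fun b => PMF.pure (a, b)) (a, b) = p a * k a b := by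
  classical
  rw [PMF.bind_apply, tsum_eq_single a]
  · rw [PMF.bind_apply, tsum_eq_single b]
    · simp
    · intro b' hb
      simp [hb.symm]
  · intro a' ha
    simp [PMF.bind_apply, ha.symm]

theorem MDP.law_map_state {n : ℕ} (hn : n + 1 < H) (z : X × A) (x : X) :
    (M.law π).map (fun τ => (τ ⟨n, Nat.lt_of_succ_lt hn⟩, (τ ⟨n + 1, hn⟩).1)) (z, x) =
      M.occ π ⟨n, Nat.lt_of_succ_lt hn⟩ z * M.trans ⟨n, Nat.lt_of_succ_lt hn⟩ z.1 z.2 x := by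
  have := congrArg (fun p => (p.map fun y => (y.1, y.2.1)) (z, x)) (M.law_map_pair π hn)
  simp only [PMF.map_comp, PMF.map_bind, PMF.pure_map, PMF.bind_const] at this
  rw [PMF.bind_map_prodMk_apply] at this
  exact this

theorem MDP.law_map_init_state (h0 : 0 < H) :
    (M.law π).map (fun τ => (τ ⟨0, h0⟩).1) = M.init := by
  have := congrArg (fun p => p.map fun y => y.1) (M.law_map_zero π h0)
  simp only [MDP.occLaw, PMF.map_comp, PMF.map_bind, PMF.pure_map, PMF.bind_const,
    PMF.bind_pure] at this
  exact this

theorem MDP.occ_zero (h0 : 0 < H) (z : X × A) :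
    M.occ π ⟨0, h0⟩ z = M.init z.1 * π ⟨0, h0⟩ z.1 z.2 := by
  rw [← MDP.occLaw_apply, MDP.law_map_zero, PMF.bind_map_prodMk_apply]

theorem MDP.occ_succ {n : ℕ} (hn : n + 1 < H) (z : X × A) :
    M.occ π ⟨n + 1, hn⟩ z = ∑' z', M.occ π ⟨n, Nat.lt_of_succ_lt hn⟩ z' *
      (M.trans ⟨n, Nat.lt_of_succ_lt hn⟩ z'.1 z'.2 z.1 * π ⟨n + 1, hn⟩ z.1 z.2) := by
  obtain ⟨x, a⟩ := z
  have := congrArg (fun p => (p.map fun y => y.2) (x, a)) (M.law_map_pair π hn)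
  simp only [PMF.map_comp, PMF.map_bind, PMF.pure_map] at this
  rw [PMF.bind_apply] at this
  simp only [PMF.bind_map_prodMk_apply] at this
  exact this

theorem MDP.tsum_occ (h : Fin H) : ∑' z, M.occ π h z = 1 :=
  (M.occLaw π h).tsum_coe

theorem MDP.occ_ne_top (h : Fin H) (z : X × A) : M.occ π h z ≠ ∞ :=
  (M.occLaw π h).apply_ne_top z

theorem MDP.measurable_prefixLaw [Countable X] [Countable A] (n : ℕ) (hn : n ≤ H)
    (τ : Fin n → X × A) : Measurable fun π : Policy X A H => M.prefixLaw π n hn τ := by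
  induction n with
  | zero => exact measurable_const
  | succ n ih =>
    have hπ : ∀ x a, Measurable fun π : Policy X A H => π ⟨n, hn⟩ x a := fun x a => by
      have h1 : Measurable fun p : PMF A => p a :=
        (measurable_pi_apply a).comp (comap_measurable fun p : PMF A => (fun a => p a))
      exact h1.comp ((measurable_pi_apply x).comp (measurable_pi_apply _))
    simp only [MDP.prefixLaw, PMF.bind_apply]
    refine Measurable.tsum fun τ' => (ih _ τ').mul ?_
    refine Measurable.tsum fun x => measurable_const.mul ?_
    exact Measurable.tsum fun a => (hπ x a).mul measurable_const

theorem MDP.measurable_occ [Countable X] [Countable A] (h : Fin H) (z : X × A) :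
    Measurable fun π : Policy X A H => M.occ π h z := by
  classical
  simp only [MDP.occ, PMF.map_apply]
  refine Measurable.tsum fun τ => ?_
  split_ifs
  · exact M.measurable_prefixLaw H le_rfl τ
  · exact measurable_const

end Marginals

/-! ### One-step model errors -/

section ModelError

variable {X A : Type*} {H : ℕ} (M N : MDP X A H) (π : Policy X A H)

/-- One-sided total variation distance of the first-state distributions. -/
noncomputable def MDP.initErr : ℝ≥0∞ := ∑' x, (N.init x - M.init x)

/-- One-sided total variation distance of the transition distributions. -/
noncomputable def MDP.transErr (h : Fin H) (z : X × A) : ℝ≥0∞ :=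
  ∑' x, (N.trans h z.1 z.2 x - M.trans h z.1 z.2 x)

theorem MDP.transErr_le_one (h : Fin H) (z : X × A) : M.transErr N h z ≤ 1 := by
  rw [← (N.trans h z.1 z.2).tsum_coe]
  exact ENNReal.tsum_le_tsum fun x => tsub_le_self

theorem MDP.initErr_sq_le (h0 : 0 < H) :
    M.initErr N ^ 2 ≤ 10 * hellingerSq (M.law π) (N.law π) := by
  have hf : ∀ (L : MDP X A H) (x : X),
      fiberSum (fun τ : Traj X A H => (τ ⟨0, h0⟩).1) (L.law π) x = 1 * L.init x := fun L x => by
    rw [← PMF.map_eq_fiberSum, L.law_map_init_state, one_mul]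
  have := mul_sq_tsum_tsub_le (fun τ : Traj X A H => (τ ⟨0, h0⟩).1) N.init.tsum_coe
    (M.law π).tsum_coe (N.law π).tsum_coe ENNReal.one_ne_top ENNReal.one_ne_top (hf M) (hf N)
  rwa [one_mul] at this

/-- Conditioning is done by restriction: the trajectories through `z` at layer `n` have mass `M.occ
π _ z`, and their next state is distributed as the transition at `z`. `mul_sq_tsum_tsub_le` applies
for each `z`, and the restricted Hellinger sums add up to the full one. -/
theorem MDP.tsum_occ_mul_transErr_sq_le {n : ℕ} (hn : n + 1 < H) :
    ∑' z, M.occ π ⟨n, Nat.lt_of_succ_lt hn⟩ z *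
        M.transErr N ⟨n, Nat.lt_of_succ_lt hn⟩ z ^ 2 ≤
      10 * hellingerSq (M.law π) (N.law π) := by
  classical
  set f : Traj X A H → X × A := fun τ => τ ⟨n, Nat.lt_of_succ_lt hn⟩
  set g : Traj X A H → X := fun τ => (τ ⟨n + 1, hn⟩).1
  rw [hellingerSq_eq, ← tsum_fiberSum f, ← ENNReal.tsum_mul_left]
  refine ENNReal.tsum_le_tsum fun z => ?_
  let R : MDP X A H → Traj X A H → ℝ≥0∞ := fun L τ => if z = f τ then L.law π τ else 0
  have hR : ∀ L : MDP X A H, ∑' τ, R L τ = L.occ π ⟨n, Nat.lt_of_succ_lt hn⟩ z := fun L => by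
    rw [MDP.occ, PMF.map_eq_fiberSum, fiberSum]
    exact tsum_congr fun τ => by simp only [R, f]; congr
  have hRg : ∀ (L : MDP X A H) (x : X), fiberSum g (R L) x =
      L.occ π ⟨n, Nat.lt_of_succ_lt hn⟩ z *
        L.trans ⟨n, Nat.lt_of_succ_lt hn⟩ z.1 z.2 x := fun L x => by
    rw [← L.law_map_state π hn, PMF.map_eq_fiberSum, fiberSum, fiberSum]
    refine tsum_congr fun τ => ?_
    by_cases h1 : z = f τ <;> by_cases h2 : x = g τ <;> simp [R, h1, h2, f, g]
  refine (mul_sq_tsum_tsub_le g (N.trans ⟨n, _⟩ z.1 z.2).tsum_coe (hR M) (hR N)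
    (M.occ_ne_top π _ z) (N.occ_ne_top π _ z) (hRg M) (hRg N)).trans ?_
  gcongr
  rw [fiberSum]
  refine ENNReal.tsum_le_tsum fun τ => ?_
  by_cases h1 : z = f τ <;> simp [R, h1, sqrtDist]

theorem MDP.tsum_law_mul (h : Fin H) (g : X × A → ℝ≥0∞) :
    ∑' τ, M.law π τ * g (τ h) = ∑' z, M.occ π h z * g z := by
  rw [← tsum_mul_fiberSum (fun τ : Traj X A H => τ h)]
  refine tsum_congr fun z => ?_
  rw [MDP.occ, PMF.map_eq_fiberSum]

/-- If the one-step errors of `M` with respect to `N`, averaged over the occupancies of `π` in `M`,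
are at most `Y`, the occupancies of `π` in `N` exceed those in `M` by little. -/
theorem MDP.exists_occ_le_add {Y : ℝ≥0∞} (h0 : M.initErr N ≤ Y)
    (hY : ∀ (n : ℕ) (hn : n + 1 < H), ∑' z, M.occ π ⟨n, Nat.lt_of_succ_lt hn⟩ z *
        M.transErr N ⟨n, Nat.lt_of_succ_lt hn⟩ z ≤ Y) (n : ℕ) (hn : n < H) :
    ∃ r : X × A → ℝ≥0∞, (∀ z, N.occ π ⟨n, hn⟩ z ≤ M.occ π ⟨n, hn⟩ z + r z) ∧
      ∑' z, r z ≤ (n + 1) * Y := by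
  have hprod : ∀ (k : Fin H) (g : X → ℝ≥0∞), ∑' z : X × A, g z.1 * π k z.1 z.2 = ∑' x, g x := by
    intro k g
    rw [ENNReal.tsum_prod']
    refine tsum_congr fun x => ?_
    change ∑' a, g x * π k x a = g x
    rw [ENNReal.tsum_mul_left, (π k x).tsum_coe, mul_one]
  induction n with
  | zero =>
    refine ⟨fun z => (N.init z.1 - M.init z.1) * π ⟨0, hn⟩ z.1 z.2, fun z => ?_, ?_⟩
    · rw [N.occ_zero, M.occ_zero, ← add_mul]
      gcongr
      exact le_add_tsub
    · rw [hprod ⟨0, hn⟩ fun x => N.init x - M.init x]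
      rw [Nat.cast_zero, zero_add, one_mul]
      exact h0
  | succ n ih =>
    obtain ⟨r, hr, hrs⟩ := ih (Nat.lt_of_succ_lt hn)
    set k : Fin H := ⟨n, Nat.lt_of_succ_lt hn⟩
    set k' : Fin H := ⟨n + 1, hn⟩
    -- The old excess is carried along by the kernel of `N`, which preserves its mass. The new
    -- excess is the one-step error weighted by the occupancy in `M`, the model in which coverage is
    -- known. With layers counted from zero, layer `n` collects the initial error and `n` transition
    -- errors.
    refine ⟨fun z => ∑' z', (r z' * (N.trans k z'.1 z'.2 z.1 * π k' z.1 z.2) +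
      M.occ π k z' * ((N.trans k z'.1 z'.2 z.1 - M.trans k z'.1 z'.2 z.1) * π k' z.1 z.2)),
      fun z => ?_, ?_⟩
    · rw [N.occ_succ π hn, M.occ_succ π hn, ← ENNReal.tsum_add]
      refine ENNReal.tsum_le_tsum fun z' => ?_
      calc N.occ π k z' * (N.trans k z'.1 z'.2 z.1 * π k' z.1 z.2)
          ≤ (M.occ π k z' + r z') * (N.trans k z'.1 z'.2 z.1 * π k' z.1 z.2) := by
            gcongr
            exact hr z'
        _ = M.occ π k z' * (N.trans k z'.1 z'.2 z.1 * π k' z.1 z.2) +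
            r z' * (N.trans k z'.1 z'.2 z.1 * π k' z.1 z.2) := add_mul _ _ _
        _ ≤ M.occ π k z' * ((M.trans k z'.1 z'.2 z.1 +
              (N.trans k z'.1 z'.2 z.1 - M.trans k z'.1 z'.2 z.1)) * π k' z.1 z.2) +
            r z' * (N.trans k z'.1 z'.2 z.1 * π k' z.1 z.2) := by
            gcongr
            exact le_add_tsub
        _ = _ := by
            rw [add_mul, mul_add]
            simp only [k, k']
            ring
    · rw [ENNReal.tsum_comm]
      have : ∀ z' : X × A, ∑' z : X × A, (r z' * (N.trans k z'.1 z'.2 z.1 * π k' z.1 z.2) +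
          M.occ π k z' * ((N.trans k z'.1 z'.2 z.1 - M.trans k z'.1 z'.2 z.1) *
            π k' z.1 z.2)) = r z' + M.occ π k z' * M.transErr N k z' := fun z' => by
        rw [ENNReal.tsum_add, ENNReal.tsum_mul_left, ENNReal.tsum_mul_left,
          hprod k' (N.trans k z'.1 z'.2), PMF.tsum_coe, mul_one,
          hprod k' fun x => N.trans k z'.1 z'.2 x - M.trans k z'.1 z'.2 x]
        rfl
      rw [tsum_congr this, ENNReal.tsum_add]
      calc _ ≤ (n + 1) * Y + Y := add_le_add hrs (hY n hn)
        _ = _ := by push_cast; ring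

end ModelError

/-! ### Policy ensembles -/

section Ensemble

variable {X A : Type*} {H : ℕ} {Pol : Set (Policy X A H)} (M N : MDP X A H)

theorem MDP.occMix_le_one (p : ProbabilityMeasure Pol) (h : Fin H) (z : X × A) :
    M.occMix p h z ≤ 1 := by
  calc M.occMix p h z ≤ ∫⁻ _, 1 ∂(p : Measure Pol) :=
        lintegral_mono fun π => (M.occLaw (π : Policy X A H) h).coe_le_one z
    _ = 1 := by simp

theorem MDP.occMix_ne_top (p : ProbabilityMeasure Pol) (h : Fin H) (z : X × A) :
    M.occMix p h z ≠ ∞ :=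
  ne_top_of_le_ne_top ENNReal.one_ne_top (M.occMix_le_one p h z)

/-- The coverage objective in terms of occupancies. -/
theorem MDP.coverage_eq (h : Fin H) (ε : ℝ) (p : ProbabilityMeasure Pol) :
    M.coverage h ε p = ⨆ π : Pol, ∑' z, M.occ π h z *
      (M.occ π h z / (M.occMix p h z + ENNReal.ofReal ε * M.occ π h z)) :=
  iSup_congr fun π => M.tsum_law_mul (π : Policy X A H) h fun z =>
    M.occ π h z / (M.occMix p h z + ENNReal.ofReal ε * M.occ π h z)

/-- The Hellinger error averaged over a policy ensemble. -/
noncomputable def MDP.hellingerMix (p : ProbabilityMeasure Pol) : ℝ≥0∞ :=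
  ∫⁻ π : Pol, hellingerSq (M.law π) (N.law π) ∂(p : Measure Pol)

theorem MDP.initErr_sq_le_hellingerMix (h0 : 0 < H) (p : ProbabilityMeasure Pol) :
    M.initErr N ^ 2 ≤ 10 * M.hellingerMix N p := by
  rw [MDP.hellingerMix, ← lintegral_const_mul' _ _ (by simp)]
  calc M.initErr N ^ 2 = ∫⁻ _, M.initErr N ^ 2 ∂(p : Measure Pol) := by simp
    _ ≤ _ := lintegral_mono fun π => M.initErr_sq_le N (π : Policy X A H) h0

theorem MDP.tsum_occMix_mul_transErr_sq_le (p : ProbabilityMeasure Pol) {n : ℕ}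
    (hn : n + 1 < H) :
    ∑' z, M.occMix p ⟨n, Nat.lt_of_succ_lt hn⟩ z *
        M.transErr N ⟨n, Nat.lt_of_succ_lt hn⟩ z ^ 2 ≤ 10 * M.hellingerMix N p := by
  rw [MDP.hellingerMix, ← lintegral_const_mul' _ _ (by simp)]
  calc _ ≤ ∑' z, ∫⁻ π : Pol, M.occ π ⟨n, Nat.lt_of_succ_lt hn⟩ z *
        M.transErr N ⟨n, Nat.lt_of_succ_lt hn⟩ z ^ 2 ∂(p : Measure Pol) :=
        ENNReal.tsum_le_tsum fun z => lintegral_mul_const_le _ _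
    _ ≤ _ := tsum_lintegral_le_lintegral_tsum _ _
    _ ≤ _ := lintegral_mono fun π => M.tsum_occ_mul_transErr_sq_le N (π : Policy X A H) hn

/-- The occupancies of a policy ensemble in two models agree up to a factor and the Hellinger
error. -/
theorem MDP.exists_occMix_le [Countable X] [Countable A] (p : ProbabilityMeasure Pol)
    (h : Fin H) : ∃ η : X × A → ℝ≥0∞,
      (∀ z, M.occMix p h z ≤ 2 * N.occMix p h z + 2 * η z) ∧
      ∑' z, η z ≤ M.hellingerMix N p := by
  refine ⟨fun z => ∫⁻ π : Pol, fiberSum (fun τ : Traj X A H => τ h)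
    (fun τ => sqrtDist (M.law π τ) (N.law π τ)) z ∂(p : Measure Pol), fun z => ?_, ?_⟩
  · rw [MDP.occMix, MDP.occMix, ← lintegral_const_mul' _ _ (by simp),
      ← lintegral_const_mul' _ _ (by simp), ← lintegral_add_left]
    · refine lintegral_mono fun π => ?_
      simp only [MDP.occ, PMF.map_eq_fiberSum]
      rw [← fiberSum_const_mul, ← fiberSum_const_mul, ← fiberSum_add]
      exact fiberSum_le _ (fun τ => le_two_mul_add_sqrtDist (PMF.apply_ne_top _ _)
        (PMF.apply_ne_top _ _)) z
    -- Splitting the integral of a sum needs subadditivity, hence a measurable summand. Countability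
    -- of `X` and `A` serves this purpose.
    · exact ((N.measurable_occ h z).comp measurable_subtype_coe).const_mul 2
  · refine (tsum_lintegral_le_lintegral_tsum _ _).trans ?_
    exact lintegral_mono fun π => (tsum_fiberSum _ _).le

end Ensemble

/-! ### Elementary inequalities for the coverage ratio -/

/-- In the application, `a` and `b` are occupancies of one policy in the estimate and the truth, and
`u` and `v` are those of the ensemble. First `b` is traded for `a` at fixed `v`, then `v` for `u`.
-/
theorem mul_div_le_of_le_add {a b r u v η ε : ℝ} (ha : 0 ≤ a) (hb : 0 ≤ b) (hr : 0 ≤ r)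
    (hu : 0 ≤ u) (hv : 0 ≤ v) (hη : 0 ≤ η) (hε : 0 < ε) (hba : b ≤ a + r)
    (huv : u ≤ 2 * v + 2 * η) :
    b * (b / (v + ε * b)) ≤ 2 * (a * (a / (u + ε * a))) + (r / ε + 2 * η / ε ^ 2) := by
  have hdiv : ∀ {x w : ℝ}, 0 ≤ x → 0 ≤ w → x / (w + ε * x) * (w + ε * x) = x := by
    intro x w hx hw
    rcases hx.eq_or_lt with rfl | hx
    · simp
    · exact div_mul_cancel₀ _ (by positivity)
  have hle : ∀ {x w : ℝ}, 0 ≤ x → 0 ≤ w → ε * (x / (w + ε * x)) ≤ 1 := by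
    intro x w hx hw
    rw [← mul_div_assoc]
    exact div_le_one_of_le₀ (by linarith) (by positivity)
  have hmono : ∀ {x y : ℝ}, 0 ≤ x → x ≤ y → x / (v + ε * x) ≤ y / (v + ε * y) := by
    intro x y hx hxy
    rcases hx.eq_or_lt with rfl | hx
    · simp only [zero_div]; positivity
    · have : 0 < y := hx.trans_le hxy
      rw [div_le_div_iff₀ (by positivity) (by positivity)]
      nlinarith
  have h1 : b * (b / (v + ε * b)) ≤ a * (a / (v + ε * a)) + r / ε := by
    have eb := hdiv hb hv
    have ea := hdiv ha hv
    have ga : 0 ≤ a / (v + ε * a) := by positivity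
    have gb : 0 ≤ b / (v + ε * b) := by positivity
    rcases le_total b a with h | h
    · have := hmono hb h
      have h2 : b * (b / (v + ε * b)) ≤ a * (a / (v + ε * a)) := by gcongr
      have : 0 ≤ r / ε := by positivity
      linarith
    -- Since `ε x² / (v + ε x) = x - v x / (v + ε x)` and the subtracted term increases with `x`,
    -- passing from `a` to `b` costs at most `(b - a) / ε`.
    · have hm := mul_le_mul_of_nonneg_left (hmono ha h) hv
      rw [← sub_le_iff_le_add', le_div_iff₀ hε]
      nlinarith
  have h2 : a * (a / (v + ε * a)) ≤ 2 * (a * (a / (u + ε * a))) + 2 * η / ε ^ 2 := by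
    have ev := hdiv ha hv
    have eu := hdiv ha hu
    have lv := hle ha hv
    have lu := hle ha hu
    have gv : 0 ≤ a / (v + ε * a) := by positivity
    have gu : 0 ≤ a / (u + ε * a) := by positivity
    set g := a / (v + ε * a)
    set k := a / (u + ε * a)
    have hgk : (ε * g) * (ε * k) ≤ 1 := mul_le_one₀ lv (by positivity) lu
    have hgk' : 2 * η * (g * k) ≤ 2 * η / ε ^ 2 := by
      rw [le_div_iff₀ (by positivity)]
      nlinarith
    have hm := mul_le_mul_of_nonneg_left huv (mul_nonneg gv gu)
    have hm' := mul_nonneg (mul_nonneg gv gu) (mul_nonneg hε.le ha)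
    -- Inserting `1 = (u + ε a) / (u + ε a)` lets `u ≤ 2 v + 2 η` act on a numerator. The surplus `2
    -- η g k` is small because `g` and `k` are at most `1 / ε`.
    calc a * g = g * (k * (u + ε * a)) := by rw [eu]; ring
      _ = g * k * u + g * k * (ε * a) := by ring
      _ ≤ 2 * k * (g * (v + ε * a)) + 2 * η * (g * k) := by nlinarith
      _ ≤ _ := by rw [ev]; linarith
  linarith

theorem div_add_mul_self_ne_top {b v e : ℝ≥0∞} (hb : b ≠ ∞) (he : e ≠ 0) :
    b / (v + e * b) ≠ ∞ := by
  rcases eq_or_ne b 0 with rfl | h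
  · simp
  · refine ENNReal.div_ne_top hb ?_
    simp [he, h]

theorem ennreal_mul_div_le_of_le_add {a b r u v η : ℝ≥0∞} {ε : ℝ} (ha : a ≠ ∞) (hb : b ≠ ∞)
    (hr : r ≠ ∞) (hu : u ≠ ∞) (hv : v ≠ ∞) (hη : η ≠ ∞) (hε : 0 < ε) (hba : b ≤ a + r)
    (huv : u ≤ 2 * v + 2 * η) :
    b * (b / (v + ENNReal.ofReal ε * b)) ≤ 2 * (a * (a / (u + ENNReal.ofReal ε * a))) +
      (ENNReal.ofReal (1 / ε) * r + ENNReal.ofReal (2 / ε ^ 2) * η) := by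
  have hε' : ENNReal.ofReal ε ≠ 0 := by simpa using hε
  have t1 := div_add_mul_self_ne_top (v := v) hb hε'
  have t2 := div_add_mul_self_ne_top (v := u) ha hε'
  have f1 : 2 * (a * (a / (u + ENNReal.ofReal ε * a))) ≠ ∞ := by finiteness
  have f2 : ENNReal.ofReal (1 / ε) * r ≠ ∞ := by finiteness
  have f3 : ENNReal.ofReal (2 / ε ^ 2) * η ≠ ∞ := by finiteness
  have f4 : ENNReal.ofReal ε * a ≠ ∞ := by finiteness
  have f5 : ENNReal.ofReal ε * b ≠ ∞ := by finiteness
  have hba' := ENNReal.toReal_mono (by finiteness) hba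
  have huv' := ENNReal.toReal_mono (by finiteness) huv
  rw [ENNReal.toReal_add (by finiteness) (by finiteness)] at hba' huv'
  simp only [ENNReal.toReal_mul, ENNReal.toReal_ofNat] at huv'
  rw [← ENNReal.toReal_le_toReal (by finiteness) (by finiteness),
    ENNReal.toReal_add f1 (by finiteness), ENNReal.toReal_add f2 f3]
  simp only [ENNReal.toReal_mul, ENNReal.toReal_div, ENNReal.toReal_ofNat,
    ENNReal.toReal_add hv f5, ENNReal.toReal_add hu f4, ENNReal.toReal_ofReal hε.le,
    ENNReal.toReal_ofReal (one_div_nonneg.2 hε.le),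
    ENNReal.toReal_ofReal (show 0 ≤ 2 / ε ^ 2 by positivity)]
  refine (mul_div_le_of_le_add ENNReal.toReal_nonneg ENNReal.toReal_nonneg ENNReal.toReal_nonneg
    ENNReal.toReal_nonneg ENNReal.toReal_nonneg ENNReal.toReal_nonneg hε hba' huv').trans_eq ?_
  ring

/-- Jensen's inequality for the convex map `v ↦ b / (v + ε b)`, in the form `n² ≤ (∑ W) (∑ W⁻¹)`. -/
theorem div_avg_le {n : ℕ} [NeZero n] {b : ℝ≥0∞} {v : Fin n → ℝ≥0∞} {ε : ℝ} (hb : b ≠ ∞)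
    (hv : ∀ i, v i ≠ ∞) (hε : 0 < ε) :
    b / ((n : ℝ≥0∞)⁻¹ * ∑ i, v i + ENNReal.ofReal ε * b) ≤
      (n : ℝ≥0∞)⁻¹ * ∑ i, b / (v i + ENNReal.ofReal ε * b) := by
  rcases eq_or_ne b 0 with rfl | hb0
  · simp
  have hn : (0 : ℝ) < n := by exact_mod_cast Nat.pos_of_ne_zero (NeZero.ne n)
  have hn' : (n : ℝ≥0∞)⁻¹ ≠ ∞ := by simp [NeZero.ne n]
  have hε' : ENNReal.ofReal ε ≠ 0 := by simpa using hε
  have hbr : 0 < b.toReal := ENNReal.toReal_pos hb0 hb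
  have t1 := div_add_mul_self_ne_top (v := (n : ℝ≥0∞)⁻¹ * ∑ i, v i) hb hε'
  have t2 := fun i => div_add_mul_self_ne_top (v := v i) hb hε'
  have f1 : ∑ i, v i ≠ ∞ := ENNReal.sum_ne_top.2 fun i _ => hv i
  have f2 : ENNReal.ofReal ε * b ≠ ∞ := by finiteness
  have f3 : ∑ i, b / (v i + ENNReal.ofReal ε * b) ≠ ∞ := ENNReal.sum_ne_top.2 fun i _ => t2 i
  rw [← ENNReal.toReal_le_toReal t1 (ENNReal.mul_ne_top hn' f3)]
  simp only [ENNReal.toReal_mul, ENNReal.toReal_div, ENNReal.toReal_inv, ENNReal.toReal_natCast,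
    ENNReal.toReal_add (ENNReal.mul_ne_top hn' f1) f2, ENNReal.toReal_sum fun i _ => hv i,
    ENNReal.toReal_sum fun i _ => t2 i, fun i => ENNReal.toReal_add (hv i) f2,
    ENNReal.toReal_ofReal hε.le]
  set W : Fin n → ℝ := fun i => (v i).toReal + ε * b.toReal with hW
  have hWpos : ∀ i, 0 < W i := fun i => by
    have := ENNReal.toReal_nonneg (a := v i)
    positivity
  have hsum : (n : ℝ)⁻¹ * ∑ i, (v i).toReal + ε * b.toReal = (n : ℝ)⁻¹ * ∑ i, W i := by
    simp only [hW, Finset.sum_add_distrib, Finset.sum_const, Finset.card_univ, Fintype.card_fin,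
      nsmul_eq_mul]
    field_simp
  have hcs : (n : ℝ) ^ 2 ≤ (∑ i, W i) * ∑ i, (W i)⁻¹ := by
    have := Finset.sum_sq_le_sum_mul_sum_of_sq_le_mul Finset.univ (r := fun _ : Fin n => (1 : ℝ))
      (f := W) (g := fun i => (W i)⁻¹) (fun i _ => (hWpos i).le)
      (fun i _ => inv_nonneg.2 (hWpos i).le) (fun i _ => by
        rw [mul_inv_cancel₀ (hWpos i).ne', one_pow])
    simpa using this
  have hWs : 0 < ∑ i, W i := Finset.sum_pos (fun i _ => hWpos i) Finset.univ_nonempty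
  rw [hsum]
  have : ∑ i, b.toReal / W i = b.toReal * ∑ i, (W i)⁻¹ := by
    rw [Finset.mul_sum]; rfl
  change _ ≤ (n : ℝ)⁻¹ * ∑ i, b.toReal / W i
  rw [this, div_le_iff₀ (by positivity)]
  calc b.toReal = (n : ℝ)⁻¹ * (n : ℝ)⁻¹ * b.toReal * (n : ℝ) ^ 2 := by field_simp
    _ ≤ (n : ℝ)⁻¹ * (n : ℝ)⁻¹ * b.toReal * ((∑ i, W i) * ∑ i, (W i)⁻¹) := by gcongr
    _ = _ := by ring

/-! ### Coverage transfer in a single round -/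

section Transfer

variable {X A : Type*} {H : ℕ} {Pol : Set (Policy X A H)} {M N : MDP X A H}
  {C ε e : ℝ}

/-- The change of measure: `a δ` is split as `(a / √s) (√s δ)` with `s` the denominator of the
coverage ratio. The first factor is controlled by coverage, the second by the Hellinger error under
`p`. -/
theorem MDP.tsum_occ_mul_transErr_le (hC : 0 ≤ C) (hε : 0 < ε) (he : 0 ≤ e)
    {p : ProbabilityMeasure Pol} (hp : M.hellingerMix N p ≤ ENNReal.ofReal e) {n : ℕ}
    (hn : n + 1 < H)
    (hcov : M.coverage ⟨n, Nat.lt_of_succ_lt hn⟩ ε p ≤ ENNReal.ofReal C) (π : Pol) :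
    ∑' z, M.occ π ⟨n, Nat.lt_of_succ_lt hn⟩ z * M.transErr N ⟨n, Nat.lt_of_succ_lt hn⟩ z ≤
      ENNReal.ofReal (C * ε + √(10 * C * e)) := by
  set h : Fin H := ⟨n, Nat.lt_of_succ_lt hn⟩
  set a := fun z => M.occ π h z
  set δ := fun z => M.transErr N h z
  set s := fun z => M.occMix p h z + ENNReal.ofReal ε * a z
  set y := ∑' z, a z * δ z
  have hδ : ∀ z, δ z ≤ 1 := M.transErr_le_one N h
  have ha : ∀ z, a z ≠ ∞ := M.occ_ne_top π h
  have hy1 : y ≤ 1 := by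
    rw [← M.tsum_occ (π : Policy X A H) h]
    exact ENNReal.tsum_le_tsum fun z => mul_le_of_le_one_right' (hδ z)
  have hy : y ≠ ∞ := ne_top_of_le_ne_top ENNReal.one_ne_top hy1
  have hf : ∑' z, a z * (a z / s z) ≤ ENNReal.ofReal C := by
    rw [M.coverage_eq] at hcov
    exact (le_iSup (fun π : Pol => ∑' z, M.occ π h z *
      (M.occ π h z / (M.occMix p h z + ENNReal.ofReal ε * M.occ π h z))) π).trans hcov
  -- The regularizing part `ε a` of `s` contributes `ε ∑ a δ² ≤ ε y` because `δ ≤ 1`, so `y`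
  -- reappears on the right.
  have hg : ∑' z, s z * δ z ^ 2 ≤ 10 * ENNReal.ofReal e + ENNReal.ofReal ε * y := by
    simp only [s, add_mul]
    rw [ENNReal.tsum_add]
    refine add_le_add ((M.tsum_occMix_mul_transErr_sq_le N p hn).trans (by gcongr)) ?_
    simp only [mul_assoc]
    rw [ENNReal.tsum_mul_left]
    gcongr
    refine ENNReal.tsum_le_tsum fun z => mul_le_mul_right ?_ _
    rw [sq]
    exact mul_le_of_le_one_right' (hδ z)
  have hk : ∀ z, (a z * δ z) ^ 2 ≤ a z * (a z / s z) * (s z * δ z ^ 2) := fun z => by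
    rcases eq_or_ne (a z) 0 with h0 | h0
    · simp [h0]
    have hs0 : s z ≠ 0 := by simp [s, h0, hε]
    have hs : s z ≠ ∞ :=
      ENNReal.add_ne_top.2 ⟨M.occMix_ne_top p h z, ENNReal.mul_ne_top (by simp) (ha z)⟩
    refine le_of_eq ?_
    calc (a z * δ z) ^ 2 = a z * a z * δ z ^ 2 := by ring
      _ = a z * (a z / s z * s z) * δ z ^ 2 := by rw [ENNReal.div_mul_cancel hs0 hs]
      _ = _ := by ring
  have hg_top : 10 * ENNReal.ofReal e + ENNReal.ofReal ε * y ≠ ∞ := by finiteness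
  have key : y ^ 2 ≤ ENNReal.ofReal C * (10 * ENNReal.ofReal e + ENNReal.ofReal ε * y) :=
    (sq_tsum_le_of_sq_le_mul (ne_top_of_le_ne_top (by simp) hf)
      (ne_top_of_le_ne_top hg_top hg) hk).trans (mul_le_mul' hf hg)
  have key' := ENNReal.toReal_mono (by finiteness) key
  rw [ENNReal.toReal_mul, ENNReal.toReal_add (by finiteness) (by finiteness)] at key'
  simp only [ENNReal.toReal_pow, ENNReal.toReal_mul, ENNReal.toReal_ofReal hC,
    ENNReal.toReal_ofReal he, ENNReal.toReal_ofReal hε.le, ENNReal.toReal_ofNat] at key'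
  rw [← ENNReal.ofReal_toReal hy]
  exact ENNReal.ofReal_le_ofReal
    (le_add_sqrt_of_sq_le (by positivity) (by positivity) (by linarith))

/-- If `p h` covers layer `h` of the model `M` for every `h`, and `M` is close to `N` on the
policies drawn from each `p h`, then `p h` covers layer `h` of `N`. -/
theorem MDP.tsum_occ_mul_ratio_le_of_coverage_le [Countable X] [Countable A] (hC : 1 ≤ C)
    (hε : 0 < ε) (he : 0 ≤ e) {p : Fin H → ProbabilityMeasure Pol}
    (hp : ∀ h, M.hellingerMix N (p h) ≤ ENNReal.ofReal e)
    (hcov : ∀ h, M.coverage h ε (p h) ≤ ENNReal.ofReal C) (h : Fin H) (π : Pol) :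
    ∑' z, N.occ π h z *
        (N.occ π h z / (N.occMix (p h) h z + ENNReal.ofReal ε * N.occ π h z)) ≤
      ENNReal.ofReal (2 * C + H * (C * ε + √(10 * C * e)) / ε + 2 * e / ε ^ 2) := by
  have hC0 : 0 ≤ C := zero_le_one.trans hC
  set Y := C * ε + √(10 * C * e)
  have hY : 0 ≤ Y := by positivity
  -- The first state does not depend on the policy, so no coverage is needed and any ensemble would
  -- do. Here `1 ≤ C` puts the error below the common bound `Y`.
  have hinit : M.initErr N ≤ ENNReal.ofReal Y := by
    have h0 : 0 < H := h.pos
    have h1 : M.initErr N ^ 2 ≤ ENNReal.ofReal Y ^ 2 := by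
      refine (M.initErr_sq_le_hellingerMix N h0 (p ⟨0, h0⟩)).trans ?_
      calc 10 * M.hellingerMix N (p ⟨0, h0⟩) ≤ ENNReal.ofReal 10 * ENNReal.ofReal e := by
            gcongr
            · simp
            · exact hp _
        _ = ENNReal.ofReal (10 * e) := (ENNReal.ofReal_mul (by norm_num)).symm
        _ ≤ ENNReal.ofReal (Y ^ 2) := by
          refine ENNReal.ofReal_le_ofReal ?_
          calc 10 * e ≤ 10 * C * e := by nlinarith
            _ = √(10 * C * e) ^ 2 := (Real.sq_sqrt (by positivity)).symm
            _ ≤ Y ^ 2 := by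
              gcongr
              exact le_add_of_nonneg_left (by positivity)
        _ = _ := ENNReal.ofReal_pow hY 2
    exact (ENNReal.pow_le_pow_left_iff two_ne_zero).1 h1
  obtain ⟨r, hr, hrs⟩ := M.exists_occ_le_add N (π : Policy X A H) hinit
    (fun n hn => M.tsum_occ_mul_transErr_le hC0 hε he (hp _) hn (hcov _) π) h h.2
  obtain ⟨η, hη, hηs⟩ := M.exists_occMix_le N (p h) h
  have hrs' : ∑' z, r z ≤ ENNReal.ofReal (H * Y) := by
    refine hrs.trans ?_
    rw [ENNReal.ofReal_mul (by positivity), ENNReal.ofReal_natCast]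
    gcongr
    exact_mod_cast h.2
  have hηs' := hηs.trans (hp h)
  have hr_top := fun z => ENNReal.ne_top_of_tsum_ne_top (ne_top_of_le_ne_top ENNReal.ofReal_ne_top hrs') z
  have hη_top := fun z => ENNReal.ne_top_of_tsum_ne_top (ne_top_of_le_ne_top (by simp) hηs') z
  have hf : ∑' z, M.occ π h z *
      (M.occ π h z / (M.occMix (p h) h z + ENNReal.ofReal ε * M.occ π h z)) ≤
        ENNReal.ofReal C := by
    have := hcov h
    rw [M.coverage_eq] at this
    exact (le_iSup (fun π : Pol => ∑' z, M.occ π h z *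
      (M.occ π h z / (M.occMix (p h) h z + ENNReal.ofReal ε * M.occ π h z))) π).trans this
  calc _ ≤ ∑' z, (2 * (M.occ π h z *
          (M.occ π h z / (M.occMix (p h) h z + ENNReal.ofReal ε * M.occ π h z))) +
        (ENNReal.ofReal (1 / ε) * r z + ENNReal.ofReal (2 / ε ^ 2) * η z)) :=
        ENNReal.tsum_le_tsum fun z => ennreal_mul_div_le_of_le_add (M.occ_ne_top π h z)
          (N.occ_ne_top π h z) (hr_top z) (M.occMix_ne_top _ h z) (N.occMix_ne_top _ h z)
          (hη_top z) hε (hr z) (hη z)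
    _ ≤ ENNReal.ofReal 2 * ENNReal.ofReal C + (ENNReal.ofReal (1 / ε) * ENNReal.ofReal (H * Y) +
        ENNReal.ofReal (2 / ε ^ 2) * ENNReal.ofReal e) := by
      rw [ENNReal.tsum_add, ENNReal.tsum_add, ENNReal.tsum_mul_left, ENNReal.tsum_mul_left,
        ENNReal.tsum_mul_left]
      gcongr
      simp
    _ = _ := by
      rw [← ENNReal.ofReal_mul (by positivity), ← ENNReal.ofReal_mul (by positivity),
        ← ENNReal.ofReal_mul (by positivity), ← ENNReal.ofReal_add (by positivity)
        (by positivity), ← ENNReal.ofReal_add (by positivity) (by positivity)]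
      congr 1
      ring

end Transfer

/-! ### Averaging over the rounds -/

theorem lintegral_unifMix {α : Type*} [MeasurableSpace α] {n : ℕ} [NeZero n]
    (p : Fin n → ProbabilityMeasure α) (f : α → ℝ≥0∞) :
    ∫⁻ a, f a ∂(unifMix p : Measure α) =
      (n : ℝ≥0∞)⁻¹ * ∑ i, ∫⁻ a, f a ∂(p i : Measure α) := by
  change ∫⁻ a, f a ∂((n : ℝ≥0∞)⁻¹ • ∑ i, (p i : Measure α)) = _
  rw [lintegral_smul_measure, lintegral_finsetSum_measure, smul_eq_mul]

/-- Each component has weight `1 / n` in the mixture. With `n = H` this costs one factor `H` in the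
error. -/
theorem MDP.hellingerMix_le_unifMix {X A : Type*} {H : ℕ} {Pol : Set (Policy X A H)}
    (M N : MDP X A H) {n : ℕ} [NeZero n] (p : Fin n → ProbabilityMeasure Pol) (i : Fin n) :
    M.hellingerMix N (p i) ≤ n * M.hellingerMix N (unifMix p) := by
  rw [MDP.hellingerMix, MDP.hellingerMix, lintegral_unifMix, ← mul_assoc,
    ENNReal.mul_inv_cancel (NeZero.ne _) (ENNReal.natCast_ne_top n), one_mul]
  exact Finset.single_le_sum (f := fun i => ∫⁻ π : Pol, hellingerSq (M.law π) (N.law π)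
    ∂(p i : Measure Pol)) (fun _ _ => zero_le) (Finset.mem_univ i)

theorem sum_sqrt_le_sqrt {n : ℕ} {x : Fin n → ℝ} (hx : ∀ i, 0 ≤ x i) :
    ∑ i, √(x i) ≤ √(n * ∑ i, x i) := by
  refine Real.le_sqrt_of_sq_le ?_
  have := sq_sum_le_card_mul_sum_sq (s := (Finset.univ : Finset (Fin n))) (f := fun i => √(x i))
  simpa [fun i => Real.sq_sqrt (hx i)] using this

/-- The constants have slack: `2 C + H C ≤ 3 H C`, while `√10` and `2` suffice in place of `12` and
`8`. The extra `H` inside the root turns `H` into `H^(3/2)`. -/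
theorem avg_round_bound_le {H T : ℕ} [NeZero T] {C ε E : ℝ} (hC : 0 ≤ C) (hH : 1 ≤ H)
    (hε : 0 < ε) {e : Fin T → ℝ} (he : ∀ t, 0 ≤ e t) (hE : ∑ t, e t ≤ E) :
    (T : ℝ)⁻¹ * ∑ t, (2 * C + H * (C * ε + √(10 * C * (H * e t))) / ε +
        2 * (H * e t) / ε ^ 2) ≤
      11 * H * C + 12 / ε * √(H ^ 3 * C * E / T) + 8 * H / ε ^ 2 * (E / T) := by
  have hT : (0 : ℝ) < T := by exact_mod_cast Nat.pos_of_ne_zero (NeZero.ne T)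
  have hH' : (1 : ℝ) ≤ H := by exact_mod_cast hH
  have hE0 : 0 ≤ E := (Finset.sum_nonneg fun t _ => he t).trans hE
  have hs : ∀ t, (H : ℝ) * √(10 * C * (H * e t)) ≤ 12 * √(H ^ 3 * C * e t) := fun t => by
    have het := he t
    refine (sq_le_sq₀ (by positivity) (by positivity)).1 ?_
    rw [mul_pow, mul_pow, Real.sq_sqrt (by positivity), Real.sq_sqrt (by positivity)]
    have : 0 ≤ (H : ℝ) ^ 3 * C * e t := by positivity
    nlinarith
  have hsum : ∑ t, √(H ^ 3 * C * e t) ≤ T * √(H ^ 3 * C * E / T) := by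
    refine (sum_sqrt_le_sqrt fun t => by have := he t; positivity).trans ?_
    rw [← Finset.mul_sum, Real.sqrt_le_iff]
    refine ⟨by positivity, ?_⟩
    rw [mul_pow, Real.sq_sqrt (by positivity)]
    calc (T : ℝ) * (H ^ 3 * C * ∑ t, e t) ≤ T * (H ^ 3 * C * E) := by gcongr
      _ = _ := by field_simp
  have hterm : ∀ t, 2 * C + H * (C * ε + √(10 * C * (H * e t))) / ε + 2 * (H * e t) / ε ^ 2 ≤
      11 * H * C + 12 / ε * √(H ^ 3 * C * e t) + 8 * H / ε ^ 2 * e t := fun t => by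
    have het := he t
    have h1 : H * (C * ε + √(10 * C * (H * e t))) / ε ≤
        H * C + 12 / ε * √(H ^ 3 * C * e t) := by
      rw [div_le_iff₀ hε]
      calc _ = H * C * ε + H * √(10 * C * (H * e t)) := by ring
        _ ≤ H * C * ε + 12 * √(H ^ 3 * C * e t) := by linarith [hs t]
        _ = _ := by field_simp
    have h2 : 2 * (H * e t) / ε ^ 2 ≤ 8 * H / ε ^ 2 * e t := by
      rw [div_mul_eq_mul_div]
      gcongr ?_ / _
      nlinarith [mul_nonneg (zero_le_one.trans hH') het]
    nlinarith [mul_le_mul_of_nonneg_right hH' hC]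
  calc _ ≤ (T : ℝ)⁻¹ * ∑ t, (11 * H * C + 12 / ε * √(H ^ 3 * C * e t) +
        8 * H / ε ^ 2 * e t) := by
        gcongr ?_ * ?_
        exact Finset.sum_le_sum fun t _ => hterm t
    _ = (T : ℝ)⁻¹ * (T * (11 * H * C) + 12 / ε * ∑ t, √(H ^ 3 * C * e t) +
        8 * H / ε ^ 2 * ∑ t, e t) := by
      simp only [Finset.sum_add_distrib, ← Finset.mul_sum, Finset.sum_const, Finset.card_univ,
        Fintype.card_fin, nsmul_eq_mul]
      ring
    _ ≤ (T : ℝ)⁻¹ * (T * (11 * H * C) + 12 / ε * (T * √(H ^ 3 * C * E / T)) +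
        8 * H / ε ^ 2 * E) := by gcongr
    _ = _ := by field_simp

/-- The deterministic guarantee: plug-in covers for estimates with small cumulative Hellinger
error yield a cover for the true model. -/
theorem coverage_unifMix_le {X A : Type*} [Countable X] [Countable A] {H T : ℕ} [NeZero H]
    [NeZero T] {Pol : Set (Policy X A H)} {C ε E : ℝ} (hC : 1 ≤ C) (hε : 0 < ε) (hE : 0 ≤ E)
    (N : MDP X A H) (M : Fin T → MDP X A H) (p : Fin T → Fin H → ProbabilityMeasure Pol)
    (hcov : ∀ t h, (M t).coverage h ε (p t h) ≤ ENNReal.ofReal C)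
    (herr : ∑ t, (M t).hellingerMix N (unifMix (p t)) ≤ ENNReal.ofReal E) (h : Fin H) :
    N.coverage h ε (unifMix fun t => p t h) ≤
      ENNReal.ofReal (11 * H * C + 12 / ε * √(H ^ 3 * C * E / T)
        + 8 * H / ε ^ 2 * (E / T)) := by
  have hC0 : 0 ≤ C := zero_le_one.trans hC
  set e' := fun t => (M t).hellingerMix N (unifMix (p t))
  have he_top : ∀ t, e' t ≠ ∞ := fun t => ENNReal.sum_ne_top.1
    (ne_top_of_le_ne_top ENNReal.ofReal_ne_top herr) t (Finset.mem_univ t)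
  set e := fun t => (e' t).toReal
  have he : ∀ t, 0 ≤ e t := fun t => ENNReal.toReal_nonneg
  have hesum : ∑ t, e t ≤ E := by
    rw [← ENNReal.toReal_sum fun t _ => he_top t]
    exact ENNReal.toReal_le_of_le_ofReal hE herr
  have hp : ∀ t h, (M t).hellingerMix N (p t h) ≤ ENNReal.ofReal (H * e t) := fun t h => by
    refine ((M t).hellingerMix_le_unifMix N (p t) h).trans_eq ?_
    rw [ENNReal.ofReal_mul (by positivity), ENNReal.ofReal_natCast,
      ENNReal.ofReal_toReal (he_top t)]
  have hT : (0 : ℝ) < T := by exact_mod_cast Nat.pos_of_ne_zero (NeZero.ne T)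
  rw [N.coverage_eq]
  refine iSup_le fun π => ?_
  have hocc : ∀ z, N.occMix (unifMix fun t => p t h) h z =
      (T : ℝ≥0∞)⁻¹ * ∑ t, N.occMix (p t h) h z := fun z => lintegral_unifMix _ _
  calc _ ≤ ∑' z, (T : ℝ≥0∞)⁻¹ * ∑ t, N.occ π h z *
        (N.occ π h z / (N.occMix (p t h) h z + ENNReal.ofReal ε * N.occ π h z)) := by
        refine ENNReal.tsum_le_tsum fun z => ?_
        rw [hocc, ← Finset.mul_sum, mul_left_comm]
        gcongr
        exact div_avg_le (N.occ_ne_top π h z) (fun t => N.occMix_ne_top _ h z) hε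
    _ = (T : ℝ≥0∞)⁻¹ * ∑ t, ∑' z, N.occ π h z *
        (N.occ π h z / (N.occMix (p t h) h z + ENNReal.ofReal ε * N.occ π h z)) := by
      rw [ENNReal.tsum_mul_left, Summable.tsum_finsetSum fun _ _ => ENNReal.summable]
    _ ≤ (T : ℝ≥0∞)⁻¹ * ∑ t, ENNReal.ofReal
        (2 * C + H * (C * ε + √(10 * C * (H * e t))) / ε + 2 * (H * e t) / ε ^ 2) := by
      gcongr with t
      exact MDP.tsum_occ_mul_ratio_le_of_coverage_le hC hε
        (mul_nonneg (Nat.cast_nonneg H) (he t)) (hp t) (hcov t) h π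
    _ = ENNReal.ofReal ((T : ℝ)⁻¹ * ∑ t,
        (2 * C + H * (C * ε + √(10 * C * (H * e t))) / ε + 2 * (H * e t) / ε ^ 2)) := by
      rw [ENNReal.ofReal_mul (by positivity), ENNReal.ofReal_inv_of_pos hT,
        ENNReal.ofReal_natCast, ENNReal.ofReal_sum_of_nonneg]
      intro t _
      have := he t
      positivity
    _ ≤ _ := ENNReal.ofReal_le_ofReal
      (avg_round_bound_le hC0 (Nat.one_le_iff_ne_zero.2 (NeZero.ne H)) hε he hesum)

end RewardFree

/-! ### The high-probability guarantee. -/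

theorem mainTheorem3 {X : Type u} {A : Type v}
    [Countable X] [MeasurableSpace X] [MeasurableSingletonClass X]
    [Countable A] [MeasurableSpace A] [MeasurableSingletonClass A]
    {H T : ℕ} [NeZero H] [NeZero T]
    (Pol : Set (Policy X A H)) (Mcl : Set (MDP X A H))
    (C ε δ Est : ℝ) (hC : 1 ≤ C) (hε : 0 < ε) (hδ₀ : 0 < δ) (hδ₁ : δ < 1) (hEst : 0 ≤ Est)
    (alg : EstimationAlg Pol Mcl) (halg : IsOnlineOracle.{u, v, w} alg T δ Est)
    (Mstar : MDP X A H) (hMstar : Mstar ∈ Mcl)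
    {Ω : Type w} [MeasurableSpace Ω] (P : Measure Ω) [IsProbabilityMeasure P]
    (𝓕 𝓖 : Fin T → MeasurableSpace Ω) (Mhat : Fin T → Ω → Mcl)
    (p : Fin T → Fin H → Ω → ProbabilityMeasure Pol)
    (pol : Fin T → Ω → Pol) (obs : Fin T → Ω → Traj X A H)
    (hrun : IsRun P alg C ε Mstar 𝓕 𝓖 Mhat p pol obs)
    (hfeas : ∀ᵐ ω ∂P, ∀ t h, PlugInFeasible Pol (Mhat t ω) h ε C) :
    P {ω | ¬ ∀ h : Fin H,
        Mstar.coverage h ε (unifMix fun t => p t h ω) ≤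
          ENNReal.ofReal (11 * H * C + 12 / ε * √(H ^ 3 * C * Est / T)
            + 8 * H / ε ^ 2 * (Est / T))}
      ≤ ENNReal.ofReal δ := by
  have hae : ∀ᵐ ω ∂P, ∀ t h, (Mhat t ω : MDP X A H).coverage h ε (p t h ω) ≤
      ENNReal.ofReal C := by
    filter_upwards [hrun.cover_solves, hfeas] with ω h1 h2 t h
    exact h1 t h (h2 t h)
  -- Probability enters only here: outside a null set, failure of the coverage bound at some layer
  -- forces failure of the oracle's error bound. One event thus serves all layers, with no union
  -- bound.
  refine (measure_mono_ae ?_).trans (halg Mstar hMstar Ω P 𝓕 𝓖 Mhat _ pol obs hrun.interaction)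
  filter_upwards [hae] with ω hω hbad herr
  exact hbad fun h => coverage_unifMix_le hC hε hEst Mstar (fun t => Mhat t ω)
    (fun t h => p t h ω) hω herr h
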